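/- Let $P(\lambda)=\sum_{i=0}^k\lambda^iA_i$ with $A_i\in\mathbb C^{n\times n}$ be a matrix polynomial of degree at most $k$, let $\lambda_0\in\mathbb C$, and let $r$ be a positive integer with $r<kn$. For $\Delta P(\lambda)=\sum_{i=0}^k\lambda^i\Delta A_i$ with $\Delta A_i\in\mathbb C^{n\times n}$ put $|||\Delta P|||_2=\|[\Delta A_0\ \cdots\ \Delta A_k]\|_2$ (spectral norm) and $|||\Delta P|||_F=\big(\sum_{i=0}^k\|\Delta A_i\|_F^2\big)^{1/2}$. For $s\in\{2,F\}$ let $$\delta_s(P,\lambda_0,r+1)=\inf\{|||\Delta P|||_s:\ P+\Delta P\text{ has an elementary divisor }(\lambda-\lambda_0)^j\text{ for some }j\ge r+1\}.$$ Here the elementary divisors of a (possibly singular) matrix polynomial $Q$ are the exact positive powers $(\lambda-\lambda_0)^{j}$ occurring in the factorizations of the nonzero diagonal entries of its Smith form. Let $\Gamma=\{\gamma=(\gamma_1,\dots,\gamma_r):\gamma_i>0\}$. For $\gamma\in\Gamma$ let $T_\gamma(P,\lambda_0)$ be the $(r+1)n\times(r+1)n$ block lower triangular matrix whose $n\times n$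 block in block row $i$ and block column $j$ ($0\le j\le i\le r$) is $\big(\prod_{l=j+1}^{i}\gamma_l\big)\frac{1}{(i-j)!}P^{(i-j)}(\lambda_0)$. Let $\sigma_i(\cdot)$ denote the $i$-th largest singular value and set $f(\gamma)=\sigma_{(r+1)n-r}(T_\gamma(P,\lambda_0))$. Let $M(\lambda_0;r)=H(\lambda_0)\otimes I_n$, where $H(\lambda_0)$ is the $(k+1)\times(\min\{r,k\}+1)$ matrix whose $(i,j)$ entry is $\frac{1}{(j-1)!}\frac{d^{j-1}\lambda^{i-1}}{d\lambda^{j-1}}\big|_{\lambda=\lambda_0}$. Put $$F_1(\gamma)=\|M(\lambda_0;r)\|_2^2\max_{1\le p\le r}\Big(1+\sum_{t=1}^p\prod_{i=t}^p\gamma_{r+1-i}^2\Big)$$ and, when $r>k$, $$F_2(\gamma)=\|M(\lambda_0;r)\|_2^2\max\Big\{\max_{1\le p\le k}\Big(1+\sum_{t=1}^p\prod_{i=t}^p\gamma_{r+1-i}^2\Big),\ \max_{k+1\le p\le r}\Big(1+\sum_{t=p-k+1}^p\prod_{i=t}^p\gamma_{r+1-i}^2\Big)\Big\}.$$ Then,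 for $s=2$ and for $s=F$, $$\delta_s(P,\lambda_0,r+1)\ \ge\ \begin{cases}\displaystyle\sup_{\gamma\in\Gamma}\frac{f(\gamma)}{\sqrt{F_1(\gamma)}} & \text{if } r\le k,\\[2ex] \displaystyle\sup_{\gamma\in\Gamma}\frac{f(\gamma)}{\sqrt{F_2(\gamma)}} & \text{if } r>k.\end{cases}$$ -/

import Mathlib

namespace MatPoly

open Polynomial

/-- The matrix polynomial `∑ i, λ ^ i A_i` with coefficients `A 0, …, A k`, as a matrix over `ℂ[X]`. -/
noncomputable def ofCoeffs {n k : ℕ} (A : Fin (k + 1) → Matrix (Fin n) (Fin n) ℂ) :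
    Matrix (Fin n) (Fin n) ℂ[X] :=
  ∑ i : Fin (k + 1), (X : ℂ[X]) ^ (i : ℕ) • (A i).map C

/-- `d` is the diagonal of the Smith form of `Q`: `Q = E * diag d * F` with `E`, `F` of nonzero constant
determinant, every `d i` monic or zero, and each entry dividing the later ones (so that the zero entries
come last). -/
def IsSmithDiagonal {n : ℕ} (Q : Matrix (Fin n) (Fin n) ℂ[X]) (d : Fin n → ℂ[X]) : Prop :=
  (∀ i, (d i).Monic ∨ d i = 0) ∧ (∀ i j, i ≤ j → d i ∣ d j) ∧
    ∃ E F : Matrix (Fin n) (Fin n) ℂ[X],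
      IsUnit E.det ∧ IsUnit F.det ∧ Q = E * Matrix.diagonal d * F

/-- `(λ - a) ^ j` is an elementary divisor of `Q`: it is the exact positive power of `λ - a` in one of
the nonzero diagonal entries (invariant polynomials) of the Smith form. `Q` may be singular. -/
def HasElementaryDivisor {n : ℕ} (Q : Matrix (Fin n) (Fin n) ℂ[X]) (a : ℂ) (j : ℕ) : Prop :=
  1 ≤ j ∧ ∃ d : Fin n → ℂ[X], IsSmithDiagonal Q d ∧ ∃ i, d i ≠ 0 ∧ (d i).rootMultiplicity a = j

open scoped Matrix.Norms.L2Operator in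
/-- The matrix `2`-norm. -/
noncomputable def norm2 {m p : Type*} [Fintype m] [Fintype p] [DecidableEq p]
    (M : Matrix m p ℂ) : ℝ := ‖M‖

open scoped Matrix.Norms.Frobenius in
/-- The Frobenius norm. -/
noncomputable def normF {m p : Type*} [Fintype m] [Fintype p] (M : Matrix m p ℂ) : ℝ := ‖M‖

/-- The two choices `s = 2` and `s = F`. -/
inductive NormKind
  | two
  | frob

/-- The block row `[A_0 ⋯ A_k]`. -/
def blockRow {n k : ℕ} (A : Fin (k + 1) → Matrix (Fin n) (Fin n) ℂ) :
    Matrix (Fin n) (Fin (k + 1) × Fin n) ℂ :=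
  Matrix.of fun a ib => A ib.1 a ib.2

/-- The norm of a matrix polynomial: `‖[A_0 ⋯ A_k]‖₂` for `s = 2` and `(∑ ‖A_i‖_F²)^(1/2)` for `s = F`. -/
noncomputable def polyNorm {n k : ℕ} (s : NormKind)
    (A : Fin (k + 1) → Matrix (Fin n) (Fin n) ℂ) : ℝ :=
  match s with
  | .two => norm2 (blockRow A)
  | .frob => √(∑ i, normF (A i) ^ 2)

/-- The distance `δ_s(P, a, q)` from `P = ∑ i, λ ^ i A_i` to the matrix polynomials
`∑ i, λ ^ i (A_i + D_i)` having an elementary divisor `(λ - a) ^ j` with `j ≥ q`; an infimum in `[0, ∞]`. -/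
noncomputable def dist {n k : ℕ} (s : NormKind) (A : Fin (k + 1) → Matrix (Fin n) (Fin n) ℂ)
    (a : ℂ) (q : ℕ) : ENNReal :=
  ⨅ D ∈ {D : Fin (k + 1) → Matrix (Fin n) (Fin n) ℂ |
      ∃ j, q ≤ j ∧ HasElementaryDivisor (ofCoeffs (A + D)) a j},
    ENNReal.ofReal (polyNorm s D)

/-- The set `Γ` of `r`-tuples of positive reals. -/
def posTuples (r : ℕ) : Set (Fin r → ℝ) := {γ | ∀ i, 0 < γ i}

/-- The entry `γ_i`, numbered from `1` to `r`; the value outside this range is never used. -/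
def entry {r : ℕ} (γ : Fin r → ℝ) (i : ℕ) : ℝ :=
  if h : 1 ≤ i ∧ i ≤ r then γ ⟨i - 1, by omega⟩ else 1

/-- `Q^{(j)}(a) / j!`. -/
noncomputable def taylor {n : ℕ} (Q : Matrix (Fin n) (Fin n) ℂ[X]) (a : ℂ) (j : ℕ) :
    Matrix (Fin n) (Fin n) ℂ :=
  ((j.factorial : ℂ)⁻¹) • Q.map fun p => (derivative^[j] p).eval a

/-- The block lower triangular `(r+1)n × (r+1)n` matrix `T_γ(Q, a)`: with block rows and columns numbered
from `0` to `r`, the block in position `(i, j)`, `j ≤ i`, is `γ_{j+1} ⋯ γ_i Q^{(i-j)}(a) / (i-j)!`. -/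
noncomputable def toeplitz {n r : ℕ} (γ : Fin r → ℝ) (Q : Matrix (Fin n) (Fin n) ℂ[X]) (a : ℂ) :
    Matrix (Fin (r + 1) × Fin n) (Fin (r + 1) × Fin n) ℂ :=
  Matrix.of fun x y =>
    if y.1 ≤ x.1 then
      ((∏ l ∈ Finset.Icc ((y.1 : ℕ) + 1) (x.1 : ℕ), entry γ l : ℝ) : ℂ) *
        taylor Q a ((x.1 : ℕ) - (y.1 : ℕ)) x.2 y.2
    else 0

/-- The `i`-th largest singular value `σ_i`, numbered from `i = 1`. -/
noncomputable def sigma {m p : Type*} [Fintype m] [Fintype p] [DecidableEq p]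
    (i : ℕ) (M : Matrix m p ℂ) : ℝ :=
  (Matrix.toEuclideanLin M).singularValues (i - 1)

/-- The `(k+1) × (min r k + 1)` matrix `H(a)`; with rows `i` and columns `j` numbered from `0`, its entry
is the value at `a` of the `j`-th derivative of `λ ^ i`, divided by `j!`. -/
noncomputable def matH (k r : ℕ) (a : ℂ) : Matrix (Fin (k + 1)) (Fin (min r k + 1)) ℂ :=
  Matrix.of fun i j =>
    (((j : ℕ).factorial : ℂ)⁻¹) * (derivative^[(j : ℕ)] ((X : ℂ[X]) ^ (i : ℕ))).eval a

/-- `M(a; r) = H(a) ⊗ I_n`. -/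
noncomputable def matM (n k r : ℕ) (a : ℂ) :
    Matrix (Fin (k + 1) × Fin n) (Fin (min r k + 1) × Fin n) ℂ :=
  Matrix.kroneckerMap (· * ·) (matH k r a) (1 : Matrix (Fin n) (Fin n) ℂ)

/-- `1 + ∑_{t = u}^{p} ∏_{i = t}^{p} γ_{r+1-i}²`. -/
noncomputable def gammaSum {r : ℕ} (γ : Fin r → ℝ) (u p : ℕ) : ℝ :=
  1 + ∑ t ∈ Finset.Icc u p, ∏ i ∈ Finset.Icc t p, entry γ (r + 1 - i) ^ 2

/-- `F₁(γ)`, for `r ≥ 1`. -/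
noncomputable def F1 (n k : ℕ) {r : ℕ} (hr : 1 ≤ r) (a : ℂ) (γ : Fin r → ℝ) : ℝ :=
  norm2 (matM n k r a) ^ 2 *
    (Finset.Icc 1 r).sup' (Finset.nonempty_Icc.2 hr) fun p => gammaSum γ 1 p

/-- `F₂(γ)`, for `1 ≤ k < r`. -/
noncomputable def F2 (n : ℕ) {k r : ℕ} (hk : 1 ≤ k) (hkr : k + 1 ≤ r) (a : ℂ) (γ : Fin r → ℝ) : ℝ :=
  norm2 (matM n k r a) ^ 2 *
    max ((Finset.Icc 1 k).sup' (Finset.nonempty_Icc.2 hk) fun p => gammaSum γ 1 p)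
      ((Finset.Icc (k + 1) r).sup' (Finset.nonempty_Icc.2 hkr) fun p => gammaSum γ (p - k + 1) p)

theorem one_le_of_lt_mul {k n r : ℕ} (h : r < k * n) : 1 ≤ k :=
  Nat.pos_of_ne_zero fun h0 => by simp [h0] at h

end MatPoly

/-! Let Q = P + ΔP have an elementary divisor (λ - a)^j with j ≥ r + 1. A column of the inverse of
the right Smith factor is a polynomial vector w with w(a) ≠ 0 and Q w ≡ 0 modulo (λ - a)^(r+1). Its
multiples p w with deg p ≤ r give an (r+1)-dimensional subspace of ker T_γ(Q)
(`exists_subspace_toeplitz_eq_zero`). Since T_γ is linear in the polynomial, T_γ(P) = -T_γ(ΔP)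
there, and a Courant–Fischer argument (`singularValues_le_of_subspace`) bounds f(γ) by ‖T_γ(ΔP)‖.

Block row i of T_γ(ΔP) v is [ΔA_0 ⋯ ΔA_k] M u_i, where u_i lists weighted blocks of v in reverse
order. Summing ‖u_i‖² over i gives ‖v_j‖² the weight `columnSum k γ j`
(`sum_norm_sq_toeplitz_mulVec_le`). The maxima in F₁ and F₂ are the largest of these weights. -/

namespace MatPoly

open Polynomial

/-! ### Singular values and matrix norms. -/

/-- If `T` is bounded by `c` on a subspace `W` whose dimension exceeds `dim E - (i + 1)`, then its
singular value number `i`, counted from zero, is at most `c`. -/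
theorem singularValues_le_of_subspace {E F : Type*} [NormedAddCommGroup E] [InnerProductSpace ℂ E]
    [FiniteDimensional ℂ E] [NormedAddCommGroup F] [InnerProductSpace ℂ F] [FiniteDimensional ℂ F]
    (T : E →ₗ[ℂ] F) (W : Submodule ℂ E) {i : ℕ} {c : ℝ} (hc : 0 ≤ c)
    (hW : Module.finrank ℂ E < Module.finrank ℂ W + (i + 1))
    (h : ∀ x ∈ W, ‖T x‖ ≤ c * ‖x‖) : T.singularValues i ≤ c := by
  rcases le_or_gt (Module.finrank ℂ E) i with hi | hi
  · rw [T.singularValues_of_finrank_le hi]; exact hc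
  have hT := T.isSymmetric_adjoint_comp_self
  set b := hT.eigenvectorBasis rfl with hb
  -- Only dim E - (i + 1) coordinates have index above i, so some nonzero x in W has none of them.
  -- On the span of the remaining eigenvectors, ‖T x‖ ≥ σ ‖x‖ with σ the singular value number i.
  let L : W →ₗ[ℂ] ({j : Fin (Module.finrank ℂ E) // i < j} → ℂ) :=
    { toFun := fun x j => b.repr (x : E) j
      map_add' := fun x y => by ext j; simp
      map_smul' := fun x y => by ext j; simp }
  have hcard : Fintype.card {j : Fin (Module.finrank ℂ E) // i < j}
      = Module.finrank ℂ E - (i + 1) := by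
    rw [Fintype.card_subtype]
    have := Fin.card_Ioi (⟨i, hi⟩ : Fin (Module.finrank ℂ E))
    rw [show Module.finrank ℂ E - (i + 1) = Module.finrank ℂ E - 1 - i by omega, ← this]
    congr 1
    ext j
    simp [Fin.lt_def]
  have hker : LinearMap.ker L ≠ ⊥ := LinearMap.ker_ne_bot_of_finrank_lt (by
    rw [Module.finrank_fintype_fun_eq_card, hcard]; omega)
  obtain ⟨x, hx, hx0⟩ := Submodule.exists_mem_ne_zero_of_ne_bot hker
  have hz : ∀ j : Fin (Module.finrank ℂ E), i < j → b.repr (x : E) j = 0 := fun j hj =>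
    congrFun (LinearMap.mem_ker.1 hx) ⟨j, hj⟩
  have hxn : 0 < ‖(x : E)‖ := norm_pos_iff.2 fun h0 => hx0 (Subtype.ext h0)
  have hsq : ‖T x‖ ^ 2 = ∑ j, hT.eigenvalues rfl j * ‖b.repr (x : E) j‖ ^ 2 := by
    have h1 : inner ℂ (x : E) ((LinearMap.adjoint T ∘ₗ T) x) = ((‖T x‖ ^ 2 : ℝ) : ℂ) := by
      rw [LinearMap.comp_apply, LinearMap.adjoint_inner_right, inner_self_eq_norm_sq_to_K]
      norm_cast
    have h2 : inner ℂ (x : E) ((LinearMap.adjoint T ∘ₗ T) x)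
        = ((∑ j, hT.eigenvalues rfl j * ‖b.repr (x : E) j‖ ^ 2 : ℝ) : ℂ) := by
      rw [← b.repr.inner_map_map, PiLp.inner_apply]
      rw [Complex.ofReal_sum]
      refine Finset.sum_congr rfl fun j _ => ?_
      rw [Complex.ofReal_mul, Complex.ofReal_pow, hT.eigenvectorBasis_apply_self_apply rfl, RCLike.inner_apply, ← hb, mul_assoc,
        RCLike.mul_conj]
      rfl
    exact_mod_cast h1.symm.trans h2
  have hn : ‖(x : E)‖ ^ 2 = ∑ j, ‖b.repr (x : E) j‖ ^ 2 := by
    rw [← b.repr.norm_map, EuclideanSpace.norm_sq_eq]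
  have hle : (T.singularValues i * ‖(x : E)‖) ^ 2 ≤ ‖T x‖ ^ 2 := by
    rw [mul_pow, hn, hsq, T.sq_singularValues_of_lt rfl hi, Finset.mul_sum]
    refine Finset.sum_le_sum fun j _ => ?_
    rcases lt_or_ge i (j : ℕ) with hj | hj
    · simp [hz j hj]
    · exact mul_le_mul_of_nonneg_right (hT.eigenvalues_antitone rfl hj) (by positivity)
  have hle' := (abs_le_of_sq_le_sq' hle (norm_nonneg _)).2.trans (h x x.2)
  exact le_of_mul_le_mul_right hle' hxn

theorem sum_norm_sq_mulVec_le {m p : Type*} [Fintype m] [Fintype p] [DecidableEq p]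
    (M : Matrix m p ℂ) (v : p → ℂ) :
    ∑ i, ‖(M.mulVec v) i‖ ^ 2 ≤ norm2 M ^ 2 * ∑ j, ‖v j‖ ^ 2 := by
  have h := Matrix.l2_opNorm_mulVec M (WithLp.toLp 2 v)
  have h2 := pow_le_pow_left₀ (norm_nonneg _) h 2
  rw [mul_pow, EuclideanSpace.norm_sq_eq, EuclideanSpace.norm_sq_eq] at h2
  exact h2

open scoped Matrix.Norms.L2Operator in
theorem norm2_nonneg {m p : Type*} [Fintype m] [Fintype p] [DecidableEq p]
    (M : Matrix m p ℂ) : 0 ≤ norm2 M :=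
  norm_nonneg M

theorem norm2_le_of_forall {m p : Type*} [Fintype m] [Fintype p] [DecidableEq p]
    (M : Matrix m p ℂ) {c : ℝ} (hc : 0 ≤ c)
    (h : ∀ v : p → ℂ, ∑ i, ‖(M.mulVec v) i‖ ^ 2 ≤ c ^ 2 * ∑ j, ‖v j‖ ^ 2) : norm2 M ≤ c := by
  unfold norm2
  rw [Matrix.l2_opNorm_def]
  refine ContinuousLinearMap.opNorm_le_bound _ hc fun x => ?_
  refine abs_le_of_sq_le_sq' ?_ (by positivity) |>.2
  rw [mul_pow, EuclideanSpace.norm_sq_eq, EuclideanSpace.norm_sq_eq]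
  exact h x

/-- Lets one spectral-norm estimate serve both choices of s; for s = F it is Cauchy–Schwarz in each
row. -/
theorem norm2_blockRow_le_polyNorm {n k : ℕ} (s : NormKind)
    (D : Fin (k + 1) → Matrix (Fin n) (Fin n) ℂ) : norm2 (blockRow D) ≤ polyNorm s D := by
  cases s with
  | two => exact le_rfl
  | frob =>
    refine norm2_le_of_forall _ (Real.sqrt_nonneg _) fun v => ?_
    have hF : ∀ B : Matrix (Fin n) (Fin n) ℂ, normF B ^ 2 = ∑ i, ∑ j, ‖B i j‖ ^ 2 := fun B => by
      unfold normF
      rw [Matrix.frobenius_norm_def, ← Real.sqrt_eq_rpow, Real.sq_sqrt (by positivity)]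
      simp
    change _ ≤ √(∑ i, normF (D i) ^ 2) ^ 2 * _
    rw [Real.sq_sqrt (by positivity)]
    have hs : ∑ i, normF (D i) ^ 2 = ∑ x, ∑ y, ‖blockRow D x y‖ ^ 2 := by
      simp only [hF, Fintype.sum_prod_type, blockRow, Matrix.of_apply]
      rw [Finset.sum_comm]
    rw [hs, Finset.sum_mul]
    refine Finset.sum_le_sum fun x _ => ?_
    calc ‖((blockRow D).mulVec v) x‖ ^ 2
        ≤ (∑ y, ‖blockRow D x y‖ * ‖v y‖) ^ 2 := by
          refine pow_le_pow_left₀ (norm_nonneg _) ?_ 2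
          simp only [Matrix.mulVec, dotProduct]
          exact (norm_sum_le _ _).trans (Finset.sum_le_sum fun y _ => (norm_mul _ _).le)
      _ ≤ _ := Finset.sum_mul_sq_le_sq_mul_sq _ _ _

/-! ### From an elementary divisor to a kernel of dimension r + 1. -/

theorem taylor_apply_eq_coeff {n : ℕ} (Q : Matrix (Fin n) (Fin n) ℂ[X]) (a : ℂ) (j : ℕ)
    (x y : Fin n) : taylor Q a j x y = (Polynomial.taylor a (Q x y)).coeff j := by
  rw [Polynomial.taylor_coeff, taylor, Matrix.smul_apply, Matrix.map_apply, smul_eq_mul,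
    ← Polynomial.factorial_smul_hasseDeriv, LinearMap.smul_apply, Polynomial.eval_smul,
    nsmul_eq_mul, inv_mul_cancel_left₀ (by exact_mod_cast j.factorial_ne_zero)]

theorem toeplitz_add {n r : ℕ} (γ : Fin r → ℝ) (P Q : Matrix (Fin n) (Fin n) ℂ[X]) (a : ℂ) :
    toeplitz γ (P + Q) a = toeplitz γ P a + toeplitz γ Q a := by
  ext x y
  simp only [toeplitz, Matrix.add_apply, Matrix.of_apply, taylor_apply_eq_coeff, map_add,
    Polynomial.coeff_add]
  split_ifs <;> ring

theorem ofCoeffs_add {n k : ℕ} (A D : Fin (k + 1) → Matrix (Fin n) (Fin n) ℂ) :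
    ofCoeffs (A + D) = ofCoeffs A + ofCoeffs D := by
  simp only [ofCoeffs, Pi.add_apply, ← Finset.sum_add_distrib]
  refine Finset.sum_congr rfl fun i _ => ?_
  rw [Matrix.map_add C (fun _ _ => C_add), smul_add]

/-- From Q F⁻¹ = E diag(d), column i of F⁻¹ is sent by Q to d_i times column i of E. Translation by
a turns powers of λ - a into powers of X. -/
theorem exists_taylor_vector {n : ℕ} {Q : Matrix (Fin n) (Fin n) ℂ[X]} {a : ℂ} {q j : ℕ}
    (hq : q ≤ j) (h : HasElementaryDivisor Q a j) :
    ∃ w : Fin n → ℂ[X], (∃ y, (w y).coeff 0 ≠ 0) ∧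
      ∀ x, X ^ q ∣ ∑ y, Polynomial.taylor a (Q x y) * w y := by
  obtain ⟨-, d, ⟨-, -, E, F, -, hF, rfl⟩, i, hd, hi⟩ := h
  refine ⟨fun y => Polynomial.taylor a (F⁻¹ y i), ?_, fun x => ?_⟩
  -- If the column vanished at a, the entry (i, i) of F F⁻¹ = 1 would evaluate to 0.
  · by_contra! hcon
    have h1 : (F * F⁻¹) i i = 1 := by rw [Matrix.mul_nonsing_inv F hF, Matrix.one_apply_eq]
    have h2 := congrArg (Polynomial.eval a) h1
    rw [Matrix.mul_apply, Polynomial.eval_finsetSum] at h2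
    simp only [Polynomial.taylor_coeff_zero] at hcon
    simp [hcon] at h2
  · have h1 : ∑ y, Polynomial.taylor a ((E * Matrix.diagonal d * F) x y)
          * Polynomial.taylor a (F⁻¹ y i) = Polynomial.taylor a (E x i * d i) := by
      simp only [← Polynomial.taylor_mul, ← map_sum]
      rw [← Matrix.mul_apply, Matrix.mul_nonsing_inv_cancel_right _ _ hF, Matrix.mul_diagonal]
    rw [h1, Polynomial.taylor_mul]
    refine Dvd.dvd.mul_left ?_ _
    obtain ⟨e, he⟩ := (Polynomial.le_rootMultiplicity_iff hd).1 (hq.trans hi.ge)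
    refine ⟨Polynomial.taylor a e, ?_⟩
    rw [he, Polynomial.taylor_mul, Polynomial.taylor_pow, map_sub, Polynomial.taylor_X,
      Polynomial.taylor_C, add_sub_cancel_right]

theorem entry_pos {r : ℕ} {γ : Fin r → ℝ} (hγ : γ ∈ posTuples r) (i : ℕ) : 0 < entry γ i := by
  unfold entry
  split_ifs with h
  · exact hγ _
  · exact one_pos

theorem prod_Icc_entry_mul {r : ℕ} (γ : Fin r → ℝ) {j i : ℕ} (h : j ≤ i) :
    (∏ l ∈ Finset.Icc (j + 1) i, entry γ l) * ∏ l ∈ Finset.Icc 1 j, entry γ l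
      = ∏ l ∈ Finset.Icc 1 i, entry γ l := by
  have e : ∀ u v, Finset.Icc (u + 1) v = Finset.Ioc u v := fun u v => by ext; simp
  rw [e, e 0 j, e 0 i, mul_comm, Finset.prod_Ioc_consecutive _ (Nat.zero_le _) h]

/-- The weighted Taylor coefficients of `p • w`, as a vector on which `toeplitz γ` acts. -/
noncomputable def coeffVector {n r : ℕ} (γ : Fin r → ℝ) (w : Fin n → ℂ[X]) :
    degreeLT ℂ (r + 1) →ₗ[ℂ] EuclideanSpace ℂ (Fin (r + 1) × Fin n) where
  toFun p := WithLp.toLp 2 fun z =>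
    ((∏ l ∈ Finset.Icc 1 (z.1 : ℕ), entry γ l : ℝ) : ℂ) * ((p : ℂ[X]) * w z.2).coeff z.1
  map_add' p q := by ext z; simp [add_mul, mul_add]
  map_smul' c p := by ext z; simp [mul_left_comm]

/-- The weights are nonzero, so a vector in the kernel has X^(r+1) ∣ p w_y with X prime to w_y; then
X^(r+1) ∣ p, impossible for nonzero p of degree at most r. -/
theorem coeffVector_injective {n r : ℕ} {γ : Fin r → ℝ} (hγ : γ ∈ posTuples r)
    {w : Fin n → ℂ[X]} {y : Fin n} (hy : (w y).coeff 0 ≠ 0) :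
    Function.Injective (coeffVector γ w) := by
  rw [← LinearMap.ker_eq_bot, LinearMap.ker_eq_bot']
  rintro ⟨p, hp⟩ h0
  have h1 : X ^ (r + 1) ∣ p * w y := by
    rw [Polynomial.X_pow_dvd_iff]
    intro m hm
    have := congrArg (fun v : EuclideanSpace ℂ (Fin (r + 1) × Fin n) => v (⟨m, hm⟩, y)) h0
    simp only [coeffVector, LinearMap.coe_mk, AddHom.coe_mk, PiLp.zero_apply, mul_eq_zero] at this
    refine this.resolve_left ?_
    exact_mod_cast (Finset.prod_pos fun l _ => entry_pos hγ l).ne'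
  have hX : ¬ X ∣ w y := by rwa [Polynomial.X_dvd_iff]
  have h2 : X ^ (r + 1) ∣ p := Polynomial.prime_X.pow_dvd_of_dvd_mul_right _ hX h1
  ext m
  rcases lt_or_ge m (r + 1) with hm | hm
  · simpa using Polynomial.X_pow_dvd_iff.1 h2 m hm
  · simpa using Polynomial.coeff_eq_zero_of_degree_lt
      ((Polynomial.mem_degreeLT.1 hp).trans_le (by exact_mod_cast hm))

/-- The weights telescope: γ_{j+1} ⋯ γ_i times γ_1 ⋯ γ_j does not depend on j, so block row i is γ_1
⋯ γ_i times coefficient i of the translated product Q p w. -/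
theorem toeplitz_coeffVector {n r : ℕ} (γ : Fin r → ℝ) (Q : Matrix (Fin n) (Fin n) ℂ[X]) (a : ℂ)
    {w : Fin n → ℂ[X]} (hw : ∀ x, X ^ (r + 1) ∣ ∑ y, Polynomial.taylor a (Q x y) * w y)
    (p : degreeLT ℂ (r + 1)) :
    Matrix.toEuclideanLin (toeplitz γ Q a) (coeffVector γ w p) = 0 := by
  ext ⟨i, x⟩
  have hdvd : X ^ (r + 1) ∣ ∑ y, Polynomial.taylor a (Q x y) * ((p : ℂ[X]) * w y) := by
    have : ∑ y, Polynomial.taylor a (Q x y) * ((p : ℂ[X]) * w y)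
        = p * ∑ y, Polynomial.taylor a (Q x y) * w y := by
      rw [Finset.mul_sum]
      exact Finset.sum_congr rfl fun y _ => by ring
    rw [this]
    exact (hw x).mul_left _
  have h0 := Polynomial.X_pow_dvd_iff.1 hdvd i i.2
  rw [Polynomial.finsetSum_coeff] at h0
  have hrow : ∀ y, ∑ j : Fin (r + 1), toeplitz γ Q a (i, x) (j, y) * coeffVector γ w p (j, y)
      = ((∏ l ∈ Finset.Icc 1 (i : ℕ), entry γ l : ℝ) : ℂ)
        * (Polynomial.taylor a (Q x y) * ((p : ℂ[X]) * w y)).coeff i := fun y => by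
    rw [mul_comm (Polynomial.taylor a (Q x y)), Polynomial.coeff_mul,
      Finset.Nat.sum_antidiagonal_eq_sum_range_succ_mk, Finset.mul_sum]
    have hsub : Finset.range ((i : ℕ) + 1) = (Finset.range (r + 1)).filter (· ≤ (i : ℕ)) := by
      ext; simp; omega
    rw [hsub, Finset.sum_filter, ← Fin.sum_univ_eq_sum_range
      (fun m => if m ≤ (i : ℕ) then ((∏ l ∈ Finset.Icc 1 (i : ℕ), entry γ l : ℝ) : ℂ) *
        (((p : ℂ[X]) * w y).coeff m * (Polynomial.taylor a (Q x y)).coeff ((i : ℕ) - m)) else 0)]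
    refine Finset.sum_congr rfl fun j _ => ?_
    simp only [toeplitz, Matrix.of_apply, coeffVector, LinearMap.coe_mk, AddHom.coe_mk,
      taylor_apply_eq_coeff, Fin.le_def]
    split_ifs with h
    · rw [← prod_Icc_entry_mul γ h]
      push_cast
      ring
    · rw [zero_mul]
  change ∑ z, toeplitz γ Q a (i, x) z * coeffVector γ w p z = 0
  rw [Fintype.sum_prod_type_right, Finset.sum_congr rfl fun y _ => hrow y, ← Finset.mul_sum, h0,
    mul_zero]

theorem exists_subspace_toeplitz_eq_zero {n r j : ℕ} {γ : Fin r → ℝ} (hγ : γ ∈ posTuples r)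
    {Q : Matrix (Fin n) (Fin n) ℂ[X]} {a : ℂ} (hj : r + 1 ≤ j)
    (h : HasElementaryDivisor Q a j) :
    ∃ W : Submodule ℂ (EuclideanSpace ℂ (Fin (r + 1) × Fin n)), Module.finrank ℂ W = r + 1 ∧
      ∀ v ∈ W, Matrix.toEuclideanLin (toeplitz γ Q a) v = 0 := by
  obtain ⟨w, ⟨y, hy⟩, hw⟩ := exists_taylor_vector hj h
  refine ⟨LinearMap.range (coeffVector γ w), ?_, ?_⟩
  · rw [LinearMap.finrank_range_of_inj (coeffVector_injective hγ hy),
      (degreeLTEquiv ℂ (r + 1)).finrank_eq, Module.finrank_fin_fun]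
  · rintro _ ⟨p, rfl⟩
    exact toeplitz_coeffVector γ Q a hw p

/-! ### The norm of the Toeplitz matrix of a perturbation. -/

theorem taylor_ofCoeffs {n k r : ℕ} (D : Fin (k + 1) → Matrix (Fin n) (Fin n) ℂ) (a : ℂ)
    (m : Fin (min r k + 1)) (x y : Fin n) :
    taylor (ofCoeffs D) a m x y = (blockRow D * matM n k r a) x (m, y) := by
  simp only [taylor, ofCoeffs, matM, matH, blockRow, Matrix.mul_apply, Matrix.smul_apply,
    Matrix.map_apply, Matrix.sum_apply, Matrix.of_apply, Matrix.kroneckerMap_apply,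
    Fintype.sum_prod_type, Matrix.one_apply, mul_ite, mul_one, mul_zero, Finset.sum_ite_eq',
    Finset.mem_univ, if_true, smul_eq_mul, Polynomial.iterate_derivative_sum,
    Polynomial.eval_finsetSum, Finset.mul_sum]
  refine Finset.sum_congr rfl fun b _ => ?_
  rw [mul_comm (X ^ (b : ℕ)), Polynomial.iterate_derivative_C_mul, Polynomial.eval_C_mul]
  ring

theorem taylor_ofCoeffs_eq_zero {n k : ℕ} (D : Fin (k + 1) → Matrix (Fin n) (Fin n) ℂ) (a : ℂ)
    {m : ℕ} (hm : k < m) (x y : Fin n) : taylor (ofCoeffs D) a m x y = 0 := by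
  rw [taylor_apply_eq_coeff]
  refine Polynomial.coeff_eq_zero_of_natDegree_lt ?_
  rw [Polynomial.natDegree_taylor]
  refine lt_of_le_of_lt ?_ hm
  simp only [ofCoeffs, Matrix.sum_apply]
  refine Polynomial.natDegree_sum_le_of_forall_le _ _ fun i _ => ?_
  simp only [Matrix.smul_apply, Matrix.map_apply, smul_eq_mul]
  exact (Polynomial.natDegree_mul_C_le _ _).trans ((Polynomial.natDegree_X_pow_le _).trans (by omega))

/-- The part of the vector `v` that block row `i` of the Toeplitz matrix acts on, reversed and weighted. -/
noncomputable def rowVector {n r : ℕ} (q : ℕ) (γ : Fin r → ℝ) (v : Fin (r + 1) × Fin n → ℂ)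
    (i : Fin (r + 1)) : Fin (q + 1) × Fin n → ℂ := fun z =>
  if (z.1 : ℕ) ≤ i then
    ((∏ l ∈ Finset.Icc ((i : ℕ) - z.1 + 1) i, entry γ l : ℝ) : ℂ) * v (⟨i - z.1, by omega⟩, z.2)
  else 0

/-- The substitution m = i - j, passing from block columns to Taylor orders and dropping those
beyond the bandwidth q. -/
theorem sum_fin_le_eq_sum_sub {M : Type*} [AddCommMonoid M] {r q : ℕ} (i : Fin (r + 1))
    (f : Fin (r + 1) → M)
    (hf : ∀ j : Fin (r + 1), j ≤ i → q < (i : ℕ) - j → f j = 0) :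
    ∑ j, (if j ≤ i then f j else 0)
      = ∑ m : Fin (q + 1), if (m : ℕ) ≤ i then f ⟨i - m, by omega⟩ else 0 := by
  have h1 : ∑ j, (if j ≤ i then f j else 0) =
      ∑ j with j ≤ i ∧ (i : ℕ) - j ≤ q, f j := by
    rw [← Finset.sum_filter]
    symm
    refine Finset.sum_subset (fun j => by simp +contextual) fun j hj hj' => ?_
    simp only [Finset.mem_filter, Finset.mem_univ, true_and, not_and, not_le] at hj hj'
    exact hf j hj (hj' hj)
  rw [h1, ← Finset.sum_filter]
  refine Finset.sum_bij' (fun j hj => ⟨(i : ℕ) - j, ?_⟩) (fun m _ => ⟨(i : ℕ) - m, by omega⟩)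
    ?_ ?_ ?_ ?_ ?_
  · simp only [Finset.mem_filter] at hj; omega
  · intro j hj; simp
  · intro m hm
    simp only [Finset.mem_filter, Finset.mem_univ, true_and, Fin.le_def] at hm ⊢
    omega
  · intro j hj
    simp only [Finset.mem_filter, Finset.mem_univ, true_and, Fin.le_def] at hj
    ext; simp; omega
  · intro m hm
    simp only [Finset.mem_filter, Finset.mem_univ, true_and] at hm
    ext; simp; omega
  · intro j hj
    simp only [Finset.mem_filter, Finset.mem_univ, true_and, Fin.le_def] at hj
    congr 1
    ext; simp; omega

theorem toeplitz_mulVec_eq {n k r : ℕ} (γ : Fin r → ℝ)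
    (D : Fin (k + 1) → Matrix (Fin n) (Fin n) ℂ) (a : ℂ) (v : Fin (r + 1) × Fin n → ℂ)
    (i : Fin (r + 1)) (x : Fin n) :
    ((toeplitz γ (ofCoeffs D) a).mulVec v) (i, x)
      = ((blockRow D).mulVec ((matM n k r a).mulVec (rowVector (min r k) γ v i))) x := by
  rw [Matrix.mulVec_mulVec]
  simp only [Matrix.mulVec, dotProduct, Fintype.sum_prod_type_right]
  refine Finset.sum_congr rfl fun y _ => ?_
  simp only [toeplitz, Matrix.of_apply, ite_mul, zero_mul]
  rw [sum_fin_le_eq_sum_sub (q := min r k)]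
  · refine Finset.sum_congr rfl fun m _ => ?_
    simp only [← taylor_ofCoeffs, rowVector, mul_ite, mul_zero]
    split_ifs with h
    · rw [Nat.sub_sub_self h]; ring
    · rfl
  · intro j hj hlt
    rw [taylor_ofCoeffs_eq_zero D a (by omega), mul_zero, zero_mul]

/-- The sum of the squared weights in block column `j` of the Toeplitz matrix of bandwidth `k`. -/
noncomputable def columnSum {r : ℕ} (k : ℕ) (γ : Fin r → ℝ) (j : ℕ) : ℝ :=
  ∑ i ∈ Finset.Icc j (min r (j + k)), (∏ l ∈ Finset.Icc (j + 1) i, entry γ l) ^ 2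

/-- Block v_j enters the vectors of rows i with j ≤ i ≤ j + k, weighted by γ_{j+1} ⋯ γ_i; the
identity regroups by j. -/
theorem sum_norm_sq_rowVector {n k r : ℕ} (γ : Fin r → ℝ) (v : Fin (r + 1) × Fin n → ℂ) :
    ∑ i, ∑ z, ‖rowVector (min r k) γ v i z‖ ^ 2
      = ∑ j : Fin (r + 1), columnSum k γ j * ∑ y, ‖v (j, y)‖ ^ 2 := by
  have h1 : ∀ i : Fin (r + 1), ∑ z, ‖rowVector (min r k) γ v i z‖ ^ 2
      = ∑ j : Fin (r + 1), if j ≤ i then (if (i : ℕ) ≤ j + k then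
        (∏ l ∈ Finset.Icc ((j : ℕ) + 1) i, entry γ l) ^ 2 * ∑ y, ‖v (j, y)‖ ^ 2 else 0) else 0 := by
    intro i
    rw [sum_fin_le_eq_sum_sub (q := min r k), Fintype.sum_prod_type]
    · refine Finset.sum_congr rfl fun m _ => ?_
      simp only [rowVector]
      split_ifs with h h'
      · rw [Finset.mul_sum]
        refine Finset.sum_congr rfl fun y _ => ?_
        rw [norm_mul, mul_pow, Complex.norm_real, Real.norm_eq_abs, sq_abs]
      · omega
      · simp
    · intro j hj hlt
      rw [if_neg (by omega)]
  simp only [h1]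
  rw [Finset.sum_comm]
  refine Finset.sum_congr rfl fun j _ => ?_
  have hset : Finset.Icc (j : ℕ) (min r (j + k))
      = (Finset.range (r + 1)).filter fun i => (j : ℕ) ≤ i ∧ i ≤ j + k := by
    ext; simp; omega
  rw [columnSum, hset, Finset.sum_filter, Finset.sum_mul, ← Fin.sum_univ_eq_sum_range
    (fun i => (if (j : ℕ) ≤ i ∧ i ≤ j + k then
      (∏ l ∈ Finset.Icc ((j : ℕ) + 1) i, entry γ l) ^ 2 else 0) * ∑ y, ‖v (j, y)‖ ^ 2)]
  refine Finset.sum_congr rfl fun i _ => ?_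
  simp only [Fin.le_def, ite_mul, zero_mul, ite_and]

theorem sum_norm_sq_toeplitz_mulVec_le {n k r : ℕ} (γ : Fin r → ℝ)
    (D : Fin (k + 1) → Matrix (Fin n) (Fin n) ℂ) (a : ℂ) {K : ℝ}
    (hK : ∀ j ≤ r, columnSum k γ j ≤ K) (v : Fin (r + 1) × Fin n → ℂ) :
    ∑ z, ‖((toeplitz γ (ofCoeffs D) a).mulVec v) z‖ ^ 2
      ≤ norm2 (blockRow D) ^ 2 * (norm2 (matM n k r a) ^ 2 * K) * ∑ z, ‖v z‖ ^ 2 := by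
  rw [Fintype.sum_prod_type]
  simp only [toeplitz_mulVec_eq]
  calc _ ≤ ∑ i, norm2 (blockRow D) ^ 2 * (norm2 (matM n k r a) ^ 2 *
          ∑ z, ‖rowVector (min r k) γ v i z‖ ^ 2) :=
        Finset.sum_le_sum fun i _ => (sum_norm_sq_mulVec_le _ _).trans
          (mul_le_mul_of_nonneg_left (sum_norm_sq_mulVec_le _ _) (sq_nonneg _))
    _ = norm2 (blockRow D) ^ 2 * norm2 (matM n k r a) ^ 2 *
          ∑ j : Fin (r + 1), columnSum k γ j * ∑ y, ‖v (j, y)‖ ^ 2 := by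
        rw [← Finset.mul_sum, ← Finset.mul_sum, sum_norm_sq_rowVector, mul_assoc]
    _ ≤ norm2 (blockRow D) ^ 2 * norm2 (matM n k r a) ^ 2 * (K * ∑ z, ‖v z‖ ^ 2) := by
        refine mul_le_mul_of_nonneg_left ?_ (by positivity)
        rw [Fintype.sum_prod_type, Finset.mul_sum]
        exact Finset.sum_le_sum fun j _ =>
          mul_le_mul_of_nonneg_right (hK j (by omega)) (by positivity)
    _ = _ := by ring

/-! ### Column sums and the final bound. -/

theorem gammaSum_eq_columnSum {k r p : ℕ} (γ : Fin r → ℝ) (hp : p ≤ r) :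
    gammaSum γ (p - k + 1) p = columnSum k γ (r - p) := by
  rw [gammaSum, columnSum, ←
    Finset.add_sum_Ioc_eq_sum_Icc (show r - p ≤ min r (r - p + k) by omega)]
  -- The summand 1 is the empty product at i = r - p; the others match under t ↦ r + 1 - t.
  congr 1
  · rw [Finset.Icc_eq_empty (by omega)]; simp
  refine Finset.sum_bij' (fun t _ => r + 1 - t) (fun i _ => r + 1 - i) ?_ ?_ ?_ ?_ ?_
  · intro t ht; simp only [Finset.mem_Icc, Finset.mem_Ioc] at *; omega
  · intro t ht; simp only [Finset.mem_Icc, Finset.mem_Ioc] at *; omega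
  · intro t ht; simp only [Finset.mem_Icc] at *; omega
  · intro t ht; simp only [Finset.mem_Ioc] at *; omega
  · intro t ht
    rw [Finset.mem_Icc] at ht
    rw [← Finset.prod_pow]
    refine Finset.prod_bij' (fun i _ => r + 1 - i) (fun i _ => r + 1 - i) ?_ ?_ ?_ ?_ ?_
    · intro i hi; simp only [Finset.mem_Icc] at *; omega
    · intro i hi; simp only [Finset.mem_Icc] at *; omega
    · intro i hi; simp only [Finset.mem_Icc] at *; omega
    · intro i hi; simp only [Finset.mem_Icc] at *; omega
    · intro i hi; rfl

theorem gammaSum_one_eq_columnSum {k r p : ℕ} (γ : Fin r → ℝ) (hp : p ≤ r) (hpk : p ≤ k) :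
    gammaSum γ 1 p = columnSum k γ (r - p) := by
  -- Truncated subtraction turns the lower limit p - k + 1 into 1.
  rw [← gammaSum_eq_columnSum γ hp, Nat.sub_eq_zero_of_le hpk]

theorem columnSum_self {k r : ℕ} (γ : Fin r → ℝ) : columnSum k γ r = 1 := by
  simp [columnSum]

theorem one_le_gammaSum {r : ℕ} (γ : Fin r → ℝ) (u p : ℕ) : 1 ≤ gammaSum γ u p :=
  le_add_of_nonneg_right (Finset.sum_nonneg fun _ _ => Finset.prod_nonneg fun _ _ => sq_nonneg _)

theorem ofReal_sigma_div_le_dist {n k r : ℕ} (hn : 1 ≤ n)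
    (A : Fin (k + 1) → Matrix (Fin n) (Fin n) ℂ) (a : ℂ) (s : NormKind) {γ : Fin r → ℝ}
    (hγ : γ ∈ posTuples r) {K : ℝ} (hK : ∀ j ≤ r, columnSum k γ j ≤ K) :
    ENNReal.ofReal (sigma ((r + 1) * n - r) (toeplitz γ (ofCoeffs A) a) /
      √(norm2 (matM n k r a) ^ 2 * K)) ≤ dist s A a (r + 1) := by
  refine le_iInf₂ fun D hD => ENNReal.ofReal_le_ofReal ?_
  obtain ⟨j, hj, hdiv⟩ := hD
  obtain ⟨W, hW, hker⟩ := exists_subspace_toeplitz_eq_zero hγ hj hdiv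
  have hP : 0 ≤ polyNorm s D := (norm2_nonneg _).trans (norm2_blockRow_le_polyNorm s D)
  have hK0 : 0 ≤ K := le_trans (by rw [columnSum_self]; exact zero_le_one) (hK r le_rfl)
  refine div_le_of_le_mul₀ (Real.sqrt_nonneg _) hP ?_
  refine singularValues_le_of_subspace _ W (by positivity) ?_ fun v hv => ?_
  -- With n ≥ 1 the subtractions in the zero-based index (r+1)n - r - 1 are not truncated, and dim W
  -- = r + 1 just suffices.
  · have : r + 1 ≤ (r + 1) * n := Nat.le_mul_of_pos_right _ hn
    rw [hW, finrank_euclideanSpace, Fintype.card_prod, Fintype.card_fin, Fintype.card_fin]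
    omega
  · have h0 := hker v hv
    rw [ofCoeffs_add, toeplitz_add, map_add, LinearMap.add_apply] at h0
    rw [eq_neg_of_add_eq_zero_left h0, norm_neg]
    refine abs_le_of_sq_le_sq' ?_ (by positivity) |>.2
    rw [mul_pow, mul_pow, Real.sq_sqrt (by positivity), EuclideanSpace.norm_sq_eq,
      EuclideanSpace.norm_sq_eq]
    refine (sum_norm_sq_toeplitz_mulVec_le γ D a hK v).trans ?_
    gcongr
    · exact norm2_nonneg _
    · exact norm2_blockRow_le_polyNorm s D

end MatPoly

theorem mainTheorem7 (n k r : ℕ) (hr : 1 ≤ r) (hrk : r < k * n)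
    (A : Fin (k + 1) → Matrix (Fin n) (Fin n) ℂ) (a : ℂ) (s : MatPoly.NormKind) :
    (r ≤ k →
      (⨆ γ ∈ MatPoly.posTuples r,
        ENNReal.ofReal
          (MatPoly.sigma ((r + 1) * n - r) (MatPoly.toeplitz γ (MatPoly.ofCoeffs A) a) /
            √(MatPoly.F1 n k hr a γ)))
      ≤ MatPoly.dist s A a (r + 1)) ∧
    (∀ hkr : k < r,
      (⨆ γ ∈ MatPoly.posTuples r,
        ENNReal.ofReal
          (MatPoly.sigma ((r + 1) * n - r) (MatPoly.toeplitz γ (MatPoly.ofCoeffs A) a) /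
            √(MatPoly.F2 n (MatPoly.one_le_of_lt_mul hrk) hkr a γ)))
      ≤ MatPoly.dist s A a (r + 1)) := by
  have hn : 1 ≤ n := Nat.pos_of_ne_zero fun h => by simp [h] at hrk
  have hk := MatPoly.one_le_of_lt_mul hrk
  refine ⟨fun hle => iSup₂_le fun γ hγ => ?_, fun hkr => iSup₂_le fun γ hγ => ?_⟩
  · refine MatPoly.ofReal_sigma_div_le_dist hn A a s hγ fun j hj => ?_
    rcases hj.eq_or_lt with rfl | hlt
    -- Column j = r would be p = 0, outside the maximum; its sum 1 is below every `gammaSum`. Other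
    -- columns use p = r - j.
    · rw [MatPoly.columnSum_self]
      exact (MatPoly.one_le_gammaSum γ 1 1).trans
        (Finset.le_sup' (fun p => MatPoly.gammaSum γ 1 p) (Finset.mem_Icc.2 ⟨le_rfl, hr⟩))
    · rw [← Nat.sub_sub_self hj,
        ← MatPoly.gammaSum_one_eq_columnSum (k := k) γ (Nat.sub_le _ _) (by omega)]
      exact Finset.le_sup' (fun p => MatPoly.gammaSum γ 1 p) (Finset.mem_Icc.2 (by omega))
  · refine MatPoly.ofReal_sigma_div_le_dist hn A a s hγ fun j hj => ?_
    rcases hj.eq_or_lt with rfl | hlt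
    · rw [MatPoly.columnSum_self]
      exact ((MatPoly.one_le_gammaSum γ 1 1).trans
        (Finset.le_sup' (fun p => MatPoly.gammaSum γ 1 p)
          (Finset.mem_Icc.2 ⟨le_rfl, hk⟩))).trans (le_max_left _ _)
    · rcases le_or_gt (r - j) k with hjk | hjk
      · rw [← Nat.sub_sub_self hj,
          ← MatPoly.gammaSum_one_eq_columnSum (k := k) γ (Nat.sub_le _ _) hjk]
        exact (Finset.le_sup' (fun p => MatPoly.gammaSum γ 1 p)
          (Finset.mem_Icc.2 (by omega))).trans (le_max_left _ _)
      · rw [← Nat.sub_sub_self hj,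
          ← MatPoly.gammaSum_eq_columnSum (k := k) γ (Nat.sub_le _ _)]
        exact (Finset.le_sup' (fun p => MatPoly.gammaSum γ (p - k + 1) p)
          (Finset.mem_Icc.2 (by omega))).trans (le_max_right _ _)
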